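/- Let $k\ge 1$ and $[k]=\{1,\dots,k\}$, with uniform distribution $\mathbf U$. For an integer $n\ge 0$, a noise parameter $\lambda>0$ and $\alpha\in(0,1)$, consider the following private-coin shuffle protocol $\mathcal P_{\mathsf{UT}}=(\mathcal R_{\mathsf{UT}},\mathcal A_{\mathsf{UT}})$, run for a number $N$ of users which is known to the users and to the analyser. Randomiser $\mathcal R_{\mathsf{UT}}$ (data point $x\in[k]$): for each $j\in[k]$, independently, send the message $(j,\mathbf 1\{x=j\})$, draw $s_j\sim\mathrm{Poi}(\lambda/N)$, and send $s_j$ further messages $(j,b_{j,t})$ with independent fair bits $b_{j,t}$. Shuffler $\mathcal S$: concatenates the message tuples of all users and applies a uniformly random permutation. Analyser $\mathcal A_{\mathsf{UT}}$: given the shuffled messages $\vec y$, let $\mu=\frac nk+\frac\lambda2$, let $N_j(\vec y)$ be the number of messages $(j,1)$ in $\vec y$, and $$Z=\frac kn\sum_{j=1}^k\Big(\big(N_j(\vec y)-\mu\big)^2-N_j(\vec y)\Big);$$ answer "not uniform" if $Z>2n\alpha^2$, and "uniform" otherwise. A randomised algorithm $\mathcal M$ on datasets of $m$ elements is $(\varepsilon',\delta')$-differentially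 private if $\Pr[\mathcal M(\vec x)\in S]\le e^{\varepsilon'}\Pr[\mathcal M(\vec x')\in S]+\delta'$ for every set $S$ of outputs and all $\vec x,\vec x'$ at Hamming distance at most one. The protocol is $(\varepsilon',\delta',\gamma)$-robustly shuffle private if, for all integers $0\le m\le N$ with $m\ge\gamma N$, the map that sends the dataset $\vec x\in[k]^m$ of $m$ honest users to the shuffled tuple of their messages (each sampled by the randomiser for $N$ users) is $(\varepsilon',\delta')$-differentially private. The protocol solves $\alpha$-uniformity testing with (Poissonised) sample complexity $n$ if, when $N\sim\mathrm{Poi}(n)$ and the $N$ users hold independent samples from a distribution $\mathbf p$ on $[k]$, the answer is "uniform" with probability at least $2/3$ if $\mathbf p=\mathbf U$, and "not uniform" with probability at least $2/3$ whenever $\frac12\|\mathbf p-\mathbf U\|_1>\alpha$. **Theorem.** There is a function $\lambda=\lambda(\varepsilon,\delta)>0$ of $\varepsilon>0$ and $\delta\in(0,1)$ such that the protocol $\mathcal P_{\mathsf{UT}}$ with noise parameter $\lambda(\varepsilon,\delta)$ satisfies the following. 1. (Privacy.) For all $\varepsilon>0$, $\alpha,\delta\in(0,1)$, $\gamma\in(0,1]$,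 and all $k$ and $n$, it is $(2\varepsilon,4\delta^\gamma,\gamma)$-robustly shuffle private. 2. (Sample complexity.) For all $\varepsilon_0>0$ and $\delta_0\in(0,1)$ there is a constant $C>0$ such that, for all $\varepsilon\in(0,\varepsilon_0]$, $\delta\in(0,\delta_0]$, $\alpha\in(0,1)$, $k\ge1$, and every integer $$n\ \ge\ C\left(\frac{k^{3/4}}{\alpha\,\varepsilon}\sqrt{\log\frac1\delta}+\frac{\sqrt k}{\alpha^2}\right),$$ it solves $\alpha$-uniformity testing with sample complexity $n$. -/

import Mathlib

open scoped NNReal ENNReal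

noncomputable section

namespace ShuffleTesting

/-! ### Sampling -/

/-- Independent draws `a 0 ~ f 0, …, a (m - 1) ~ f (m - 1)`: the product distribution. -/
def indep {β : Type} : (m : ℕ) → (Fin m → PMF β) → PMF (Fin m → β)
  | 0, _ => PMF.pure Fin.elim0
  | m + 1, f =>
      (f 0).bind fun b =>
        (indep m fun i => f i.succ).map fun g => (Fin.cons b g : Fin (m + 1) → β)

/-- The Poisson distribution `Poi(r)` on `ℕ`. -/
def poisson (r : ℝ≥0) : PMF ℕ :=
  (ProbabilityTheory.poissonMeasure r).toPMF

/-- The distribution `Ber(1/2)` of a fair bit. -/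
def fairBit : PMF Bool := PMF.uniformOfFintype Bool

/-! ### Differential privacy and the shuffle model -/

/-- `(ε, δ)`-differential privacy of a randomised algorithm on datasets of `m` elements
(with countable, hence discrete, output), adjacency meaning Hamming distance at most one. -/
def IsDP {X Z : Type} [DecidableEq X] {m : ℕ} (M : (Fin m → X) → PMF Z) (ε δ : ℝ) : Prop :=
  ∀ x x' : Fin m → X, hammingDist x x' ≤ 1 → ∀ S : Set Z,
    (M x).toOuterMeasure S ≤
      ENNReal.ofReal (Real.exp ε) * (M x').toOuterMeasure S + ENNReal.ofReal δ

/-- The shuffler: a uniformly random permutation of a tuple of messages. -/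
def shuffle {Y : Type} (y : List Y) : PMF (List Y) :=
  (PMF.uniformOfFintype (Equiv.Perm (Fin y.length))).map fun σ =>
    List.ofFn fun i => y.get (σ i)

/-- `𝒮 ∘ ℛ^m`: each of `m` users applies the randomiser `R` to their own data point with
independent coins; the tuples of messages are concatenated and then shuffled. -/
def shuffledMessages {X Y : Type} (R : X → PMF (List Y)) {m : ℕ} (x : Fin m → X) :
    PMF (List Y) :=
  (indep m fun i => R (x i)).bind fun y => shuffle (List.ofFn y).flatten

/-- A private-coin (non-interactive) shuffle protocol. The number `N` of users is known to the
users and to the analyser, so the randomiser and the analyser may both depend on it. -/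
structure Protocol (X Y Z : Type) where
  /-- `randomiser N x`: the random tuple of messages sent, in a protocol designed for `N` users,
  by a user with data point `x`. -/
  randomiser : ℕ → X → PMF (List Y)
  /-- `analyser N y`: the random output, in a protocol designed for `N` users, on the
  shuffled tuple of messages `y`. -/
  analyser : ℕ → List Y → PMF Z

/-- `(ε, δ, γ)`-robust shuffle privacy: for every number `N` of users that the protocol is run for,
if at least a fraction `γ` of them (`m` out of `N`) follow the protocol, then the shuffled messages
of these `m` honest users are `(ε, δ)`-differentially private. -/
def Protocol.IsRobustlyShufflePrivate {X Y Z : Type} [DecidableEq X] (P : Protocol X Y Z)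
    (ε δ γ : ℝ) : Prop :=
  ∀ N m : ℕ, γ * (N : ℝ) ≤ (m : ℝ) → m ≤ N →
    IsDP (fun x : Fin m → X => shuffledMessages (P.randomiser N) x) ε δ

/-- The output of the protocol on the dataset `x` of `N` users. -/
def Protocol.run {X Y Z : Type} (P : Protocol X Y Z) {N : ℕ} (x : Fin N → X) : PMF Z :=
  (shuffledMessages (P.randomiser N) x).bind (P.analyser N)

/-! ### Uniformity testing -/

/-- The two answers of a uniformity tester. -/
inductive Verdict
  | uniform
  | notUniform

/-- Total variation distance `½ ‖p - q‖₁`. -/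
def tvDist {k : ℕ} (p q : PMF (Fin k)) : ℝ :=
  (∑ j, |(p j).toReal - (q j).toReal|) / 2

/-- The output of the protocol on a Poissonised sample: `N ~ Poi(n)` users, each of
whom holds one independent sample from `p`. -/
def Protocol.runPoissonised {X Y Z : Type} (P : Protocol X Y Z) (n : ℕ) (p : PMF X) : PMF Z :=
  (poisson (n : ℝ≥0)).bind fun N => (indep N fun _ => p).bind fun x => P.run x

/-- `P` is an `α`-uniformity tester over `[k]` with (Poissonised) sample complexity `n`. -/
def SolvesUniformityTesting {k : ℕ} [NeZero k] {Y : Type} (P : Protocol (Fin k) Y Verdict)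
    (α : ℝ) (n : ℕ) : Prop :=
  2 / 3 ≤ P.runPoissonised n (PMF.uniformOfFintype (Fin k)) Verdict.uniform ∧
  ∀ p : PMF (Fin k), α < tvDist p (PMF.uniformOfFintype (Fin k)) →
    2 / 3 ≤ P.runPoissonised n p Verdict.notUniform

/-! ### The protocol `P_UT` -/

/-- The messages that a user with data point `x` sends about the domain element `j`, when there are
`N` users: the informative message `(j, 𝟙{x = j})`, followed by `s ~ Poi(lam / N)` noise messages
`(j, b_t)` with independent fair bits `b_t`. -/
def blockUT {k : ℕ} (lam : ℝ≥0) (N : ℕ) (x j : Fin k) : PMF (List (Fin k × Bool)) :=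
  (poisson (lam / (N : ℝ≥0))).bind fun s =>
    (indep s fun _ => fairBit).map fun b =>
      (j, decide (x = j)) :: List.ofFn fun t => (j, b t)

/-- The randomiser `R_UT`: the concatenation over all `j` in `[k]` of independent blocks. -/
def randomiserUT {k : ℕ} (lam : ℝ≥0) (N : ℕ) (x : Fin k) : PMF (List (Fin k × Bool)) :=
  (indep k fun j => blockUT lam N x j).map fun b => (List.ofFn b).flatten

/-- The statistic
`Z = (k / n) ∑_j ((N_j - μ)² - N_j)`, with `N_j` the number of messages `(j, 1)` and
`μ = n / k + lam / 2`. -/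
def statisticZ {k : ℕ} (n : ℕ) (lam : ℝ≥0) (y : List (Fin k × Bool)) : ℝ :=
  let μ : ℝ := (n : ℝ) / (k : ℝ) + (lam : ℝ) / 2
  (k : ℝ) / (n : ℝ) *
    ∑ j : Fin k, (((y.count (j, true) : ℝ) - μ) ^ 2 - (y.count (j, true) : ℝ))

/-- The (deterministic) analyser `A_UT`: answer "not uniform" exactly if `Z > 2 n α²`. -/
def analyserUT {k : ℕ} (n : ℕ) (lam : ℝ≥0) (α : ℝ) (y : List (Fin k × Bool)) : PMF Verdict :=
  open Classical in
  PMF.pure (if 2 * (n : ℝ) * α ^ 2 < statisticZ n lam y then .notUniform else .uniform)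

/-- The protocol `P_UT = (R_UT, A_UT)`. -/
def protocolUT (k n : ℕ) (lam : ℝ≥0) (α : ℝ) : Protocol (Fin k) (Fin k × Bool) Verdict where
  randomiser N x := randomiserUT lam N x
  analyser _ y := analyserUT n lam α y

end ShuffleTesting

end

/-!
The shuffler reveals exactly the histogram of the messages, since permuting a tuple uniformly at
random forgets everything but the histogram (`exists_shuffle_eq`). All laws of histograms are
computed in the commutative monoid of probability mass functions under convolution: the histogram
of independent users is the product of the histograms of the users (`indep_map_sum`), and Poisson
splitting (`compoundPoisson_map_single`) turns a Poisson number of random items into independent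
Poisson counts. So `m` users of the protocol for `N` users produce the histogram of their
informative messages plus independent noise `Poi(m lam / (2 N))` in every cell
(`histLaw_randomiserUT`).

*Privacy.* Replacing one data point moves one item between the two cells of each of two domain
elements. The density of Poisson noise changes under such moves by ratios of neighbouring counts,
which exceed `exp ε` only if two independent counts with the same law are unbalanced; a Chernoff
bound makes this unlikely (`poissonVec_ratio_tail`, `poissonVec_bind_shift_le`). The noise
`24 log(1/δ) / min(ε, 1)²` is chosen so that the exponent in this bound is `(m / N) log(1/δ)`.

*Sample complexity.* With a Poisson number of users, the numbers of messages `(j, 1)` are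
independent with laws `Poi(n p_j + lam / 2)`, except when there are no users at all, in which case
there is no noise either (`map_verdictUT_le`). For a count with law `Poi(ν)`, the summand
`(N_j - μ)² - N_j` has mean `(ν - μ)²` and variance `2 ν² + 4 (ν - μ)² ν`, by the factorial moments
of the Poisson distribution. Chebyshev's inequality then bounds both errors of the test
(`sum_excess_tail_of_uniform`, `sum_excess_tail_of_far`), because by the Cauchy–Schwarz inequality
the mean of the statistic for an `α`-far distribution is at least twice the threshold
(`four_mul_sq_le_of_tvDist`).
-/

namespace ShuffleTesting

open MeasureTheory ProbabilityTheory
open scoped Nat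

/-! ### The convolution monoid of probability mass functions -/

/-- Probability mass functions on a commutative additive monoid form a commutative monoid: the
product `p * q` is the law of `X + Y` for independent `X ~ p` and `Y ~ q` (convolution), and `1` is
the point mass at `0`. -/
noncomputable instance convCommMonoid {M : Type} [AddCommMonoid M] : CommMonoid (PMF M) where
  mul p q := p.bind fun a => q.map (a + ·)
  one := PMF.pure 0
  mul_assoc p q r := by
    change (p.bind fun a => q.map (a + ·)).bind (fun a => r.map (a + ·)) =
      p.bind fun a => (q.bind fun b => r.map (b + ·)).map (a + ·)
    simp [PMF.bind_bind, PMF.bind_map, PMF.map_bind, PMF.map_comp, Function.comp_def, add_assoc]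
  one_mul p := by
    change (PMF.pure 0).bind (fun a => p.map (a + ·)) = p
    simpa [Function.id_def] using PMF.map_id p
  mul_one p := by
    change p.bind (fun a => (PMF.pure 0).map (a + ·)) = p
    simp [PMF.pure_map]
  mul_comm p q := by
    change p.bind (fun a => q.map (a + ·)) = q.bind (fun a => p.map (a + ·))
    simp only [← PMF.bind_pure_comp]
    rw [PMF.bind_comm]
    simp [Function.comp_def, add_comm]

section Convolution

variable {M M' : Type} [AddCommMonoid M] [AddCommMonoid M']

theorem conv_def (p q : PMF M) : p * q = p.bind fun a => q.map (a + ·) := rfl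

theorem conv_one_def : (1 : PMF M) = PMF.pure 0 := rfl

theorem pure_conv (a : M) (q : PMF M) : PMF.pure a * q = q.map (a + ·) := by
  rw [conv_def, PMF.pure_bind]

theorem pure_conv_pure (a b : M) : PMF.pure a * PMF.pure b = PMF.pure (a + b) := by
  rw [pure_conv, PMF.pure_map]

theorem prod_pure {ι : Type*} (s : Finset ι) (a : ι → M) :
    ∏ i ∈ s, PMF.pure (a i) = PMF.pure (∑ i ∈ s, a i) := by
  classical
  induction s using Finset.induction_on with
  | empty => rfl
  | insert i s hi ih => rw [Finset.prod_insert hi, Finset.sum_insert hi, ih, pure_conv_pure]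

theorem bind_conv {β : Type} (p : PMF β) (f : β → PMF M) (q : PMF M) :
    p.bind f * q = p.bind fun b => f b * q := by
  simp only [conv_def, PMF.bind_bind]

/-- Pushing forward along an additive homomorphism respects convolution. -/
noncomputable def mapHom (F : M →+ M') : PMF M →* PMF M' where
  toFun p := p.map F
  map_one' := by simp [conv_one_def, PMF.pure_map]
  map_mul' p q := by
    simp [conv_def, PMF.map_bind, PMF.bind_map, PMF.map_comp, Function.comp_def]

theorem mapHom_apply (F : M →+ M') (p : PMF M) : mapHom F p = p.map F := rfl

/-- The sum of independent draws is distributed according to the convolution of their laws. -/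
theorem indep_map_sum {β : Type} (F : β → M) (m : ℕ) (f : Fin m → PMF β) :
    (indep m f).map (fun g => ∑ i, F (g i)) = ∏ i, (f i).map F := by
  induction m with
  | zero => simp [indep, PMF.pure_map, conv_one_def]
  | succ m ih =>
    rw [Fin.prod_univ_succ, ← ih]
    simp [indep, PMF.map_bind, PMF.map_comp, Function.comp_def, Fin.sum_univ_succ, conv_def,
      PMF.bind_map]

/-- The compound Poisson law: the sum of `Poi(r)` many independent draws from `p`. -/
noncomputable def compoundPoisson (r : ℝ≥0) (p : PMF M) : PMF M :=
  (poisson r).bind fun s => p ^ s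

end Convolution

/-! ### Vectors of independent Poisson variables -/

section PoissonVec

theorem poisson_apply (r : ℝ≥0) (n : ℕ) :
    poisson r n = ENNReal.ofReal (Real.exp (-r) * r ^ n / n !) := by
  rw [poisson, Measure.toPMF_apply, poissonMeasure_singleton]

theorem poisson_mul_factorial (r : ℝ≥0) (n : ℕ) :
    poisson r n * (n ! : ℝ≥0∞) = ENNReal.ofReal (Real.exp (-r)) * (r : ℝ≥0∞) ^ n := by
  rw [poisson_apply, ← ENNReal.ofReal_natCast, ← ENNReal.ofReal_mul (by positivity),
    div_mul_cancel₀ _ (by positivity), ENNReal.ofReal_mul (by positivity),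
    ENNReal.ofReal_pow (by positivity), ENNReal.ofReal_coe_nnreal]

variable {ι : Type} [Fintype ι]

/-- The law of a vector of independent counts, the `i`-th of them distributed as `Poi(ν i)`. -/
noncomputable def poissonVec (ν : ι → ℝ≥0) : PMF (ι → ℕ) :=
  (Measure.pi fun i => poissonMeasure (ν i)).toPMF

theorem poissonVec_toMeasure (ν : ι → ℝ≥0) :
    (poissonVec ν).toMeasure = Measure.pi fun i => poissonMeasure (ν i) :=
  Measure.toPMF_toMeasure _

theorem poissonVec_apply (ν : ι → ℝ≥0) (c : ι → ℕ) :
    poissonVec ν c = ∏ i, poisson (ν i) (c i) := by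
  rw [poissonVec, Measure.toPMF_apply, Measure.pi_singleton]
  rfl

theorem conv_toMeasure {M : Type} [AddCommMonoid M] [Countable M] [MeasurableSpace M]
    [MeasurableSingletonClass M] (p q : PMF M) :
    (p * q).toMeasure = p.toMeasure ∗ q.toMeasure := by
  ext s hs
  rw [conv_def, PMF.toMeasure_bind_apply _ _ _ hs, Measure.conv,
    Measure.map_apply .of_discrete hs, Measure.prod_apply (.of_discrete), lintegral_countable']
  refine tsum_congr fun a => ?_
  rw [PMF.toMeasure_apply_singleton _ _ (measurableSet_singleton a), mul_comm,
    PMF.toMeasure_map_apply _ _ _ .of_discrete hs]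
  rfl

theorem poissonVec_mul (ν ν' : ι → ℝ≥0) :
    poissonVec ν * poissonVec ν' = poissonVec (ν + ν') := by
  apply PMF.toMeasure_injective
  rw [conv_toMeasure]
  simp only [poissonVec_toMeasure, Measure.conv]
  rw [← (measurePreserving_arrowProdEquivProdArrow ℕ ℕ ι _ _).map_eq,
    Measure.map_map .of_discrete (MeasurableEquiv.measurable _)]
  have h := Measure.pi_map_pi (μ := fun i => (poissonMeasure (ν i)).prod (poissonMeasure (ν' i)))
    (f := fun (_ : ι) (x : ℕ × ℕ) => x.1 + x.2) (fun i => .of_discrete)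
  have h2 : ∀ i, ((poissonMeasure (ν i)).prod (poissonMeasure (ν' i))).map
      (fun x : ℕ × ℕ => x.1 + x.2) = poissonMeasure (ν i + ν' i) := fun i =>
    poissonMeasure_conv_poissonMeasure _ _
  simp only [h2] at h
  exact h

theorem poissonVec_zero : poissonVec (0 : ι → ℝ≥0) = 1 := by
  have h : poissonMeasure 0 = Measure.dirac 0 := by
    refine Measure.ext_of_singleton fun n => ?_
    rw [poissonMeasure_singleton]
    cases n <;> simp
  rw [conv_one_def, ← PMF.toMeasure_inj, poissonVec_toMeasure]
  refine Measure.ext_of_singleton fun c => ?_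
  rw [Measure.pi_singleton, PMF.toMeasure_apply_singleton _ _ (measurableSet_singleton c)]
  simp only [Pi.zero_apply, h, PMF.pure_apply]
  split_ifs with hc
  · simp [hc]
  · obtain ⟨i, hi⟩ := Function.ne_iff.mp hc
    exact Finset.prod_eq_zero (Finset.mem_univ i) (by
      rw [Measure.dirac_apply' _ (measurableSet_singleton _)]
      exact Set.indicator_of_notMem (fun h => hi (Set.mem_singleton_iff.mp h).symm) _)

theorem prod_poissonVec {κ : Type*} (s : Finset κ) (ν : κ → ι → ℝ≥0) :
    ∏ j ∈ s, poissonVec (ν j) = poissonVec (∑ j ∈ s, ν j) := by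
  classical
  induction s using Finset.induction_on with
  | empty => simp [poissonVec_zero]
  | insert i s hi ih => rw [Finset.prod_insert hi, Finset.sum_insert hi, ih, poissonVec_mul]

theorem map_single_conv_apply [DecidableEq ι] (p : PMF ι) (q : PMF (ι → ℕ)) (c : ι → ℕ) :
    (p.map (fun i => (Pi.single i 1 : ι → ℕ)) * q) c =
      ∑ i, p i * if 1 ≤ c i then q (c - Pi.single i 1) else 0 := by
  rw [conv_def, PMF.bind_map, PMF.bind_apply, tsum_fintype]
  refine Finset.sum_congr rfl fun i _ => ?_
  congr 1
  simp only [Function.comp_apply, PMF.map_apply]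
  split_ifs with h
  · rw [tsum_eq_single (c - Pi.single i 1)]
    · rw [if_pos]
      ext j
      by_cases hj : j = i
      · subst hj; simp; omega
      · simp [hj]
    · intro b hb
      rw [if_neg]
      rintro rfl
      exact hb (by simp)
  · refine ENNReal.tsum_eq_zero.mpr fun b => if_neg ?_
    rintro rfl
    exact h (by simp)

/-- The multinomial distribution of the histogram of `s` independent draws from `p`. -/
theorem map_single_pow_apply [DecidableEq ι] (p : PMF ι) (s : ℕ) (c : ι → ℕ) :
    (p.map (fun i => (Pi.single i 1 : ι → ℕ)) ^ s) c * ∏ i, ((c i)! : ℝ≥0∞) =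
      if ∑ i, c i = s then (s ! : ℝ≥0∞) * ∏ i, p i ^ c i else 0 := by
  induction s generalizing c with
  | zero =>
    rw [pow_zero, conv_one_def, PMF.pure_apply]
    by_cases hc : c = 0
    · simp [hc]
    · have : ¬ ∑ i, c i = 0 := fun h =>
        hc (funext fun i => by simpa using (Finset.sum_eq_zero_iff.mp h) i)
      simp only [if_neg hc, if_neg this, zero_mul]
  | succ s ih =>
    rw [pow_succ', map_single_conv_apply, Finset.sum_mul]
    -- the histograms whose first draw has type `i` contribute a share `c i / (s + 1)`
    have key : ∀ i, (p i * if 1 ≤ c i then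
          (p.map (fun i => (Pi.single i 1 : ι → ℕ)) ^ s) (c - Pi.single i 1) else 0) *
            ∏ j, ((c j)! : ℝ≥0∞) =
        (c i : ℝ≥0∞) * if ∑ j, c j = s + 1 then (s ! : ℝ≥0∞) * ∏ j, p j ^ c j else 0 := by
      intro i
      by_cases hi : 1 ≤ c i
      · obtain ⟨d, rfl⟩ : ∃ d, c = d + Pi.single i 1 := by
          refine ⟨c - Pi.single i 1, (tsub_add_cancel_of_le fun j => ?_).symm⟩
          by_cases hj : j = i
          · subst hj; simpa using hi
          · simp [hj]
        have hsplit : ∀ f : ι → ℕ → ℝ≥0∞, ∀ a : ℝ≥0∞, f i (d i + 1) = a * f i (d i) →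
            ∏ j, f j ((d + Pi.single i 1 : ι → ℕ) j) = a * ∏ j, f j (d j) := by
          intro f a hf
          rw [← Finset.mul_prod_erase _ _ (Finset.mem_univ i),
            ← Finset.mul_prod_erase _ (fun j => f j (d j)) (Finset.mem_univ i), ← mul_assoc]
          congr 1
          · simpa using hf
          · refine Finset.prod_congr rfl fun j hj => ?_
            simp [Finset.ne_of_mem_erase hj]
        rw [if_pos hi, add_tsub_cancel_right,
          hsplit (fun j n => (n ! : ℝ≥0∞)) ((d i : ℝ≥0∞) + 1) (by simp [Nat.factorial_succ]),
          hsplit (fun j n => p j ^ n) (p i) (pow_succ' _ _)]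
        have hsum : ∑ j, (d + Pi.single i 1 : ι → ℕ) j = ∑ j, d j + 1 := by
          simp [Finset.sum_add_distrib]
        rw [hsum]
        calc _ = p i * ((d i : ℝ≥0∞) + 1) * ((p.map (fun i => (Pi.single i 1 : ι → ℕ)) ^ s) d *
              ∏ j, ((d j)! : ℝ≥0∞)) := by ring
          _ = _ := by
            rw [ih]
            by_cases h : ∑ j, d j = s
            · simp [h]; ring
            · simp [h]
      · have : c i = 0 := by omega
        simp [this]
    simp only [key]
    rw [← Finset.sum_mul, ← Nat.cast_sum]
    split_ifs with h
    · rw [h, Nat.factorial_succ]; push_cast; ring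
    · simp

/-- **Poisson splitting.** If a `Poi(r)` number of items are independently given types drawn from
`p`, then the numbers of items of the various types are independent, with laws `Poi(r * p i)`. -/
theorem compoundPoisson_map_single [DecidableEq ι] (r : ℝ≥0) (p : PMF ι) :
    compoundPoisson r (p.map fun i => (Pi.single i 1 : ι → ℕ)) =
      poissonVec fun i => r * (p i).toNNReal := by
  ext c
  have hfac : ∏ i, ((c i)! : ℝ≥0∞) ≠ 0 :=
    Finset.prod_ne_zero_iff.mpr fun i _ => by simpa using (c i).factorial_ne_zero
  have hfac' : ∏ i, ((c i)! : ℝ≥0∞) ≠ ⊤ :=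
    ENNReal.prod_ne_top fun i _ => ENNReal.natCast_ne_top _
  refine (ENNReal.mul_left_inj hfac hfac').mp ?_
  rw [poissonVec_apply, ← Finset.prod_mul_distrib]
  simp only [poisson_mul_factorial]
  rw [compoundPoisson, PMF.bind_apply, ← ENNReal.tsum_mul_right]
  simp only [mul_assoc, map_single_pow_apply]
  rw [tsum_eq_single (∑ i, c i) (fun s hs => by rw [if_neg hs.symm, mul_zero]), if_pos rfl,
    ← mul_assoc, poisson_mul_factorial, Finset.prod_mul_distrib]
  have hp : ∀ i, ((p i).toNNReal : ℝ≥0∞) = p i := fun i => ENNReal.coe_toNNReal (p.apply_ne_top i)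
  have hp1 : ∑ i, (p i).toNNReal = 1 := by
    have := p.tsum_coe
    rw [tsum_fintype] at this
    rw [← ENNReal.coe_inj, ENNReal.ofNNReal_finsetSum]
    simpa [hp] using this
  rw [← ENNReal.ofReal_prod_of_nonneg (fun i _ => (Real.exp_pos _).le), ← Real.exp_sum]
  have : ∑ i, -((r * (p i).toNNReal : ℝ≥0) : ℝ) = -r := by
    rw [Finset.sum_neg_distrib, ← NNReal.coe_sum, ← Finset.mul_sum, hp1, mul_one]
  rw [this]
  simp only [ENNReal.coe_mul, hp, mul_pow, Finset.prod_mul_distrib, Finset.prod_pow_eq_pow_sum]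
  ring

end PoissonVec

/-! ### The shuffler sees only the histogram of the messages -/

section Histogram

variable {ι : Type} [DecidableEq ι]

/-- The histogram of a tuple of messages. -/
def countVec (y : List ι) : ι → ℕ := fun i => y.count i

theorem countVec_cons (a : ι) (y : List ι) :
    countVec (a :: y) = Pi.single a 1 + countVec y := by
  ext i
  by_cases h : a = i
  · subst h; simp [countVec, add_comm]
  · simp [countVec, h, Ne.symm h]

theorem countVec_append (y z : List ι) : countVec (y ++ z) = countVec y + countVec z := by
  ext i
  simp [countVec]

theorem countVec_ofFn {n : ℕ} (f : Fin n → ι) :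
    countVec (List.ofFn f) = ∑ t, Pi.single (f t) 1 := by
  induction n with
  | zero => ext i; simp [countVec]
  | succ n ih => rw [List.ofFn_succ, countVec_cons, ih, Fin.sum_univ_succ]

theorem countVec_flatten_ofFn {n : ℕ} (y : Fin n → List ι) :
    countVec (List.ofFn y).flatten = ∑ i, countVec (y i) := by
  induction n with
  | zero => ext i; simp [countVec]
  | succ n ih => rw [List.ofFn_succ, List.flatten_cons, countVec_append, ih, Fin.sum_univ_succ]

theorem card_fiber_get (y : List ι) (a : ι) :
    Fintype.card {i // y.get i = a} = countVec y a := by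
  have h : (Finset.univ : Finset (Fin y.length)).val.map y.get = (y : Multiset ι) := by
    simp [Fin.univ_def]
  rw [countVec, ← Multiset.coe_count, ← h, Multiset.count_map, Fintype.card_subtype]
  simp only [eq_comm (a := a)]
  rfl

theorem uniformOfFintype_map_equiv {α β : Type} [Fintype α] [Nonempty α] [Fintype β] [Nonempty β]
    (e : α ≃ β) : (PMF.uniformOfFintype α).map e = PMF.uniformOfFintype β := by
  ext b
  rw [PMF.map_apply, tsum_eq_single (e.symm b)]
  · simp [Fintype.card_congr e]
  · intro a ha
    rw [if_neg]
    rintro rfl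
    simp at ha

theorem shuffle_congr {y z : List ι} (h : countVec y = countVec z) : shuffle y = shuffle z := by
  have e₀ : ∀ a, {i // y.get i = a} ≃ {i // z.get i = a} := fun a =>
    Fintype.equivOfCardEq (by rw [card_fiber_get, card_fiber_get, h])
  let e : Fin y.length ≃ Fin z.length := Equiv.ofFiberEquiv e₀
  have he : ∀ i, z.get (e i) = y.get i := Equiv.ofFiberEquiv_map e₀
  have hlen : y.length = z.length := by simpa using Fintype.card_congr e
  rw [shuffle, shuffle, ← uniformOfFintype_map_equiv (Equiv.equivCongr (finCongr hlen) e),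
    PMF.map_comp]
  congr 1
  ext1 σ
  rw [List.ofFn_congr hlen]
  simp only [Function.comp_apply, Equiv.equivCongr_apply_apply, he]
  rfl

theorem countVec_shuffle (y : List ι) : (shuffle y).map countVec = PMF.pure (countVec y) := by
  rw [shuffle, PMF.map_comp]
  have : (countVec ∘ fun σ : Equiv.Perm (Fin y.length) => List.ofFn fun i => y.get (σ i)) =
      Function.const _ (countVec y) := by
    ext σ i
    exact (((σ.ofFn_comp_perm y.get).trans (by rw [List.ofFn_get])).count_eq i)
  rw [this, PMF.map_const]

/-- Given its histogram, the shuffled tuple is independent of everything else: the shuffler is a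
post-processing of the histogram. -/
theorem exists_shuffle_eq : ∃ Q : (ι → ℕ) → PMF (List ι), ∀ y, shuffle y = Q (countVec y) := by
  have h : Function.FactorsThrough shuffle (countVec (ι := ι)) := fun _ _ h => shuffle_congr h
  exact ⟨Function.extend countVec shuffle fun _ => PMF.pure [], fun y => (h.extend_apply _ y).symm⟩

/-- The law of the histogram of all messages of the users. -/
noncomputable def histLaw {X : Type} (R : X → PMF (List ι)) {m : ℕ} (x : Fin m → X) :
    PMF (ι → ℕ) :=
  ∏ i, (R (x i)).map countVec

theorem indep_map_countVec {m : ℕ} (f : Fin m → PMF (List ι)) :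
    (indep m f).map (fun y => countVec (List.ofFn y).flatten) = ∏ i, (f i).map countVec := by
  simp only [countVec_flatten_ofFn]
  exact indep_map_sum _ m _

theorem shuffledMessages_eq_bind {X : Type} (R : X → PMF (List ι)) {Q : (ι → ℕ) → PMF (List ι)}
    (hQ : ∀ y, shuffle y = Q (countVec y)) {m : ℕ} (x : Fin m → X) :
    shuffledMessages R x = (histLaw R x).bind Q := by
  rw [histLaw, ← indep_map_countVec, PMF.bind_map, shuffledMessages]
  simp only [hQ]
  rfl

theorem shuffledMessages_map_countVec {X : Type} (R : X → PMF (List ι)) {m : ℕ} (x : Fin m → X) :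
    (shuffledMessages R x).map countVec = histLaw R x := by
  rw [shuffledMessages, PMF.map_bind, histLaw, ← indep_map_countVec]
  simp only [countVec_shuffle]
  rfl

end Histogram

/-! ### The histogram of the messages of the protocol -/

section Randomiser

variable {k : ℕ}

/-- The histogram of the informative messages of a user with data point `x`. -/
def dataVec (x : Fin k) : Fin k × Bool → ℕ := ∑ j, Pi.single (j, decide (x = j)) 1

theorem dataVec_apply (x j : Fin k) (b : Bool) :
    dataVec x (j, b) = if b = decide (x = j) then 1 else 0 := by
  rw [dataVec, Finset.sum_apply, Finset.sum_eq_single j]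
  · simp [Pi.single_apply]
  · intro i _ hi
    simp [hi.symm]
  · simp

theorem blockUT_map_countVec (lam : ℝ≥0) (N : ℕ) (x j : Fin k) :
    (blockUT lam N x j).map countVec = PMF.pure (Pi.single (j, decide (x = j)) 1) *
      poissonVec fun i => if i.1 = j then lam / N / 2 else 0 := by
  have h1 : (poissonVec fun i : Fin k × Bool => if i.1 = j then lam / N / 2 else 0) =
      compoundPoisson (lam / N) (fairBit.map fun b => (Pi.single (j, b) 1 : Fin k × Bool → ℕ)) := by
    have := compoundPoisson_map_single (lam / N) (fairBit.map fun b => (j, b))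
    rw [PMF.map_comp] at this
    rw [Function.comp_def] at this
    rw [this]
    congr 1
    ext1 ⟨i, b⟩
    have hb : (fairBit.map fun b => (j, b)) (i, b) = if i = j then 2⁻¹ else 0 := by
      rw [PMF.map_apply, tsum_fintype]
      by_cases hi : i = j <;> cases b <;> simp [fairBit, hi]
    rw [hb]
    by_cases hi : i = j
    · simp [hi, div_eq_mul_inv, ENNReal.toNNReal_ofNat]
    · simp [hi]
  rw [h1, compoundPoisson, mul_comm, bind_conv, blockUT, PMF.map_bind]
  congr 1
  ext1 s
  rw [PMF.map_comp, mul_comm, pure_conv]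
  have h2 := indep_map_sum (fun b => (Pi.single (j, b) 1 : Fin k × Bool → ℕ)) s fun _ => fairBit
  rw [Finset.prod_const, Finset.card_univ, Fintype.card_fin] at h2
  rw [← h2, PMF.map_comp]
  congr 1
  ext1 b
  simp only [Function.comp_apply, countVec_cons, countVec_ofFn]

theorem randomiserUT_map_countVec (lam : ℝ≥0) (N : ℕ) (x : Fin k) :
    (randomiserUT lam N x).map countVec =
      PMF.pure (dataVec x) * poissonVec fun _ => lam / N / 2 := by
  rw [randomiserUT, PMF.map_comp]
  have h := indep_map_countVec (fun j => blockUT lam N x j)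
  rw [Function.comp_def, h]
  simp only [blockUT_map_countVec]
  rw [Finset.prod_mul_distrib, prod_pure, prod_poissonVec]
  congr 2
  ext1 i
  simp

/-- The histogram of the messages of `m` users is the histogram of their informative messages plus
independent Poisson noise. -/
theorem histLaw_randomiserUT (lam : ℝ≥0) (N : ℕ) {m : ℕ} (x : Fin m → Fin k) :
    histLaw (randomiserUT lam N) x =
      PMF.pure (∑ i, dataVec (x i)) * poissonVec fun _ => m * (lam / N / 2) := by
  simp only [histLaw, randomiserUT_map_countVec]
  rw [Finset.prod_mul_distrib, prod_pure, prod_poissonVec]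
  congr 2
  ext1 i
  simp

end Randomiser

/-! ### Poisson noise hides the moves of single items -/

section PoissonNoise

theorem lintegral_exp_mul_poissonMeasure (μ : ℝ≥0) (t : ℝ) :
    ∫⁻ n : ℕ, ENNReal.ofReal (Real.exp (t * n)) ∂poissonMeasure μ =
      ENNReal.ofReal (Real.exp (μ * (Real.exp t - 1))) := by
  have hs : HasSum (fun n : ℕ => Real.exp (t * n) * (Real.exp (-μ) * μ ^ n / n !))
      (Real.exp (μ * (Real.exp t - 1))) := by
    convert! (NormedSpace.expSeries_div_hasSum_exp ((μ : ℝ) * Real.exp t)).mul_left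
      (Real.exp (-μ)) using 1
    · ext n
      rw [mul_pow, ← Real.exp_nat_mul, mul_comm t]
      ring
    · rw [← Real.exp_eq_exp_ℝ, ← Real.exp_add]
      ring_nf
  rw [lintegral_countable']
  simp only [poissonMeasure_singleton]
  rw [← hs.tsum_eq, ENNReal.ofReal_tsum_of_nonneg (fun n => by positivity) hs.summable]
  exact tsum_congr fun n => (ENNReal.ofReal_mul (by positivity)).symm

variable {ι : Type} [Fintype ι]

/-- Chernoff bound: two independent counts with the same law `Poi(μ)` differ by a factor of more
than `exp ε` only with small probability. -/
theorem poissonVec_ratio_tail {i j : ι} (hij : i ≠ j) (μ : ℝ≥0) {ε : ℝ} (hε : 0 < ε)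
    (hε1 : ε ≤ 1) :
    (poissonVec fun _ : ι => μ).toMeasure {c | Real.exp ε * c i < c j + 1} ≤
      ENNReal.ofReal (Real.exp (1 / 6 - μ * ε ^ 2 / 12)) := by
  rw [poissonVec_toMeasure]
  set P := Measure.pi fun _ : ι => poissonMeasure μ
  -- the exponent that nearly minimises the resulting bound
  set t : ℝ := ε / 6 with ht
  set f : ℕ → ℝ≥0∞ := fun n => ENNReal.ofReal (Real.exp (t * n))
  set g : ℕ → ℝ≥0∞ := fun n => ENNReal.ofReal (Real.exp (-(t * Real.exp ε) * n))
  have hind : IndepFun (fun c : ι → ℕ => c j) (fun c => c i) P :=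
    (iIndepFun_pi (X := fun _ : ι => (id : ℕ → ℕ)) fun _ => aemeasurable_id).indepFun hij.symm
  have hind' : IndepFun (fun c : ι → ℕ => f (c j)) (fun c => g (c i)) P :=
    hind.comp (.of_discrete : Measurable f) (.of_discrete : Measurable g)
  have hf : ∫⁻ c, f (c j) ∂P = ENNReal.ofReal (Real.exp (μ * (Real.exp t - 1))) := by
    rw [← lintegral_exp_mul_poissonMeasure]
    exact (measurePreserving_eval (fun _ : ι => poissonMeasure μ) j).lintegral_comp
      (f := f) .of_discrete
  have hg : ∫⁻ c, g (c i) ∂P =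
      ENNReal.ofReal (Real.exp (μ * (Real.exp (-(t * Real.exp ε)) - 1))) := by
    rw [← lintegral_exp_mul_poissonMeasure]
    exact (measurePreserving_eval (fun _ : ι => poissonMeasure μ) i).lintegral_comp
      (f := g) .of_discrete
  calc P {c | Real.exp ε * c i < c j + 1}
      = ∫⁻ c, Set.indicator {c : ι → ℕ | Real.exp ε * c i < c j + 1} 1 c ∂P :=
        (lintegral_indicator_one (.of_discrete)).symm
    _ ≤ ∫⁻ c, ENNReal.ofReal (Real.exp t) * (f (c j) * g (c i)) ∂P := by
        refine lintegral_mono fun c => ?_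
        by_cases hc : c ∈ {c : ι → ℕ | Real.exp ε * c i < c j + 1}
        swap
        · rw [Set.indicator_of_notMem hc]
          exact zero_le
        rw [Set.indicator_of_mem hc]
        simp only [f, g, Pi.one_apply]
        rw [← ENNReal.ofReal_mul (by positivity), ← ENNReal.ofReal_mul (by positivity),
          ← Real.exp_add, ← Real.exp_add, ENNReal.one_le_ofReal, Real.one_le_exp_iff]
        have hc' : Real.exp ε * c i < c j + 1 := hc
        have : 0 < t := by positivity
        nlinarith
    _ = ENNReal.ofReal (Real.exp (t + (μ * (Real.exp t - 1) +
          μ * (Real.exp (-(t * Real.exp ε)) - 1)))) := by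
        rw [lintegral_const_mul _ .of_discrete,
          lintegral_mul_eq_lintegral_mul_lintegral_of_indepFun''
            (Measurable.of_discrete).aemeasurable (Measurable.of_discrete).aemeasurable hind', hf, hg, Real.exp_add t, Real.exp_add,
          ENNReal.ofReal_mul (by positivity), ENNReal.ofReal_mul (by positivity)]
    _ ≤ _ := by
        apply ENNReal.ofReal_le_ofReal
        apply Real.exp_le_exp.mpr
        have ht0 : 0 < t := by positivity
        have h1 : Real.exp t ≤ 1 + t + t ^ 2 := by
          have := Real.abs_exp_sub_one_sub_id_le (x := t) (by rw [abs_of_pos ht0]; linarith)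
          linarith [le_abs_self (Real.exp t - 1 - t)]
        set u := t * (1 + ε) with hu
        have hu0 : 0 ≤ u := by positivity
        have hu1 : u ≤ 1 := by nlinarith
        have h2 : Real.exp (-(t * Real.exp ε)) ≤ 1 - u + u ^ 2 / 2 := by
          have h3 : -(t * Real.exp ε) ≤ -u := by
            have := Real.add_one_le_exp ε
            nlinarith
          refine (Real.exp_le_exp.mpr h3).trans ?_
          have h4 := Real.quadratic_le_exp_of_nonneg hu0
          rw [Real.exp_neg, inv_le_iff_one_le_mul₀ (Real.exp_pos _)]
          have h5 : 0 ≤ 1 - u + u ^ 2 / 2 := by nlinarith [sq_nonneg (u - 1)]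
          nlinarith [mul_le_mul_of_nonneg_left h4 h5, sq_nonneg (u ^ 2)]
        have h6 : Real.exp t - 1 + (Real.exp (-(t * Real.exp ε)) - 1) ≤ -(ε ^ 2 / 12) := by
          have h7 : u ^ 2 ≤ 4 * t ^ 2 := by
            have : u ≤ 2 * t := by nlinarith
            nlinarith
          have h8 : t ^ 2 = ε ^ 2 / 36 := by rw [ht]; ring
          have h9 : u = t + 6 * t ^ 2 := by rw [hu, ht]; ring
          linarith
        have h10 := mul_le_mul_of_nonneg_left h6 μ.coe_nonneg
        have h11 : t ≤ 1 / 6 := by rw [ht]; linarith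
        linarith

theorem poissonVec_add_single_mul [DecidableEq ι] (ν : ι → ℝ≥0) (c : ι → ℕ) (i : ι) :
    poissonVec ν (c + Pi.single i 1) * (c i + 1) = ν i * poissonVec ν c := by
  simp only [poissonVec_apply]
  rw [← Finset.mul_prod_erase _ _ (Finset.mem_univ i),
    ← Finset.mul_prod_erase _ (fun j => poisson (ν j) (c j)) (Finset.mem_univ i)]
  have h1 : ∏ x ∈ Finset.univ.erase i, poisson (ν x) ((c + Pi.single i 1 : ι → ℕ) x) =
      ∏ x ∈ Finset.univ.erase i, poisson (ν x) (c x) :=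
    Finset.prod_congr rfl fun j hj => by simp [Finset.ne_of_mem_erase hj]
  have h2 : poisson (ν i) ((c + Pi.single i 1 : ι → ℕ) i) * (c i + 1) =
      ν i * poisson (ν i) (c i) := by
    have hfac : ((c i)! : ℝ≥0∞) ≠ 0 := by simpa using (c i).factorial_ne_zero
    refine (ENNReal.mul_left_inj hfac (ENNReal.natCast_ne_top _)).mp ?_
    have := poisson_mul_factorial (ν i) (c i + 1)
    rw [Nat.factorial_succ] at this
    push_cast at this
    rw [mul_assoc, mul_assoc, poisson_mul_factorial]
    simp only [Pi.add_apply, Pi.single_eq_same]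
    rw [this, pow_succ]
    ring
  rw [h1, ← mul_assoc, ← h2]
  ring

theorem poissonVec_add_two_singles_mul [DecidableEq ι] (μ : ℝ≥0) (c : ι → ℕ) {i j : ι}
    (hij : i ≠ j) :
    poissonVec (fun _ => μ) (c + (Pi.single i 1 + Pi.single j 1)) * ((c i + 1) * (c j + 1)) =
      μ ^ 2 * poissonVec (fun _ => μ) c := by
  have h1 := poissonVec_add_single_mul (fun _ => μ) (c + Pi.single i 1) j
  have h2 := poissonVec_add_single_mul (fun _ => μ) c i
  simp only [Pi.add_apply, Pi.single_eq_of_ne hij.symm, add_zero] at h1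
  rw [← add_assoc, mul_comm ((c i : ℝ≥0∞) + 1), ← mul_assoc, h1, mul_assoc, h2]
  ring

/-- Moving two items between the cells of a histogram with Poisson noise changes the probability of
any event by a factor of at most `exp (2 ε)`, apart from the rare histograms in which the noise in
the cells involved is unbalanced. -/
theorem poissonVec_bind_shift_le [DecidableEq ι] {β : Type} (μ : ℝ≥0) {ε : ℝ} (hε : 0 < ε)
    (hε1 : ε ≤ 1) {i j i' j' : ι} (hij : i ≠ j) (hij' : i' ≠ j') (hii' : i ≠ i') (hjj' : j ≠ j')
    (hi'j : i' ≠ j) (hj'i : j' ≠ i) (Q : (ι → ℕ) → PMF β) (S : Set β) :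
    ((poissonVec fun _ : ι => μ).bind
        fun c => Q (c + (Pi.single i' 1 + Pi.single j' 1))).toOuterMeasure S ≤
      ENNReal.ofReal (Real.exp (2 * ε)) * ((poissonVec fun _ : ι => μ).bind
        fun c => Q (c + (Pi.single i 1 + Pi.single j 1))).toOuterMeasure S +
      2 * ENNReal.ofReal (Real.exp (1 / 6 - μ * ε ^ 2 / 12)) := by
  set P := poissonVec fun _ : ι => μ with hP
  set u : ι → ℕ := Pi.single i 1 + Pi.single j 1 with hu
  set u' : ι → ℕ := Pi.single i' 1 + Pi.single j' 1 with hu'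
  set B₁ : Set (ι → ℕ) := {c | Real.exp ε * c i < c i' + 1} with hB₁
  set B₂ : Set (ι → ℕ) := {c | Real.exp ε * c j < c j' + 1} with hB₂
  rw [PMF.toOuterMeasure_bind_apply, PMF.toOuterMeasure_bind_apply]
  set F : (ι → ℕ) → ℝ≥0∞ := fun c => (Q c).toOuterMeasure S with hF
  have hF1 : ∀ c, F c ≤ 1 := fun c => by
    simp only [hF, PMF.toOuterMeasure_apply]
    rw [← (Q c).tsum_coe]
    exact ENNReal.tsum_le_tsum fun b => Set.indicator_le_self _ _ _
  -- `B₁` and `B₂` collect the unbalanced histograms; `G` is the contribution of all others, whose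
  -- counts in the cells `i` and `j` are positive, so that they have the form `d + u`
  set G : (ι → ℕ) → ℝ≥0∞ := (B₁ ∪ B₂)ᶜ.indicator fun c => P c * F (c + u') with hG
  have hsplit : ∀ c, P c * F (c + u') ≤
      G c + (B₁.indicator P c + B₂.indicator P c) := by
    intro c
    by_cases hc : c ∈ B₁ ∪ B₂
    · have h1 : P c * F (c + u') ≤ P c := mul_le_of_le_one_right' (hF1 _)
      rcases hc with hc | hc
      · rw [Set.indicator_of_mem hc]
        exact h1.trans (le_add_left le_self_add)
      · rw [Set.indicator_of_mem hc]
        exact h1.trans (le_add_left le_add_self)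
    · rw [hG, Set.indicator_of_mem hc]
      exact le_self_add
  have hbad : ∑' c, (B₁.indicator P c + B₂.indicator P c) ≤
      2 * ENNReal.ofReal (Real.exp (1 / 6 - μ * ε ^ 2 / 12)) := by
    rw [ENNReal.tsum_add, ← PMF.toMeasure_apply_eq_tsum, ← PMF.toMeasure_apply_eq_tsum, two_mul]
    exact add_le_add (poissonVec_ratio_tail hii' μ hε hε1) (poissonVec_ratio_tail hjj' μ hε hε1)
  have hgood_pos : ∀ c ∉ B₁ ∪ B₂, 1 ≤ c i ∧ 1 ≤ c j := by
    intro c hc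
    have h1 : ¬ Real.exp ε * c i < c i' + 1 := fun h => hc (Or.inl h)
    have h2 : ¬ Real.exp ε * c j < c j' + 1 := fun h => hc (Or.inr h)
    constructor
    · by_contra h
      exact h1 (by rw [Nat.lt_one_iff.mp (not_le.mp h)]; push_cast; rw [mul_zero]; positivity)
    · by_contra h
      exact h2 (by rw [Nat.lt_one_iff.mp (not_le.mp h)]; push_cast; rw [mul_zero]; positivity)
  have hsupp : Function.support G ⊆ Set.range fun d : ι → ℕ => d + u := by
    intro c hc
    have hc' : c ∉ B₁ ∪ B₂ := by
      intro h
      exact hc (by rw [hG]; exact Set.indicator_of_notMem (s := (B₁ ∪ B₂)ᶜ) (fun h' => h' h) _)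
    obtain ⟨h1, h2⟩ := hgood_pos c hc'
    refine ⟨c - u, tsub_add_cancel_of_le fun l => ?_⟩
    by_cases hl : l = i
    · subst hl; simpa [hu, hij] using h1
    · by_cases hl' : l = j
      · subst hl'; simpa [hu, hl] using h2
      · simp [hu, hl, hl']
  have hinj : Function.Injective fun d : ι → ℕ => d + u := add_left_injective u
  have hinj' : Function.Injective fun d : ι → ℕ => d + u' := add_left_injective u'
  have hratio : ∀ d, G (d + u) ≤
      ENNReal.ofReal (Real.exp (2 * ε)) * (P (d + u') * F (d + u' + u)) := by
    intro d
    by_cases hd : d + u ∈ B₁ ∪ B₂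
    · rw [hG, Set.indicator_of_notMem (s := (B₁ ∪ B₂)ᶜ) (fun h => h hd)]
      exact zero_le
    rw [hG, Set.indicator_of_mem hd, ← mul_assoc, add_right_comm]
    refine mul_le_mul_left ?_ _
    have h1 : ¬ Real.exp ε * ((d + u) i : ℕ) < ((d + u) i' : ℕ) + 1 := fun h => hd (Or.inl h)
    have h2 : ¬ Real.exp ε * ((d + u) j : ℕ) < ((d + u) j' : ℕ) + 1 := fun h => hd (Or.inr h)
    simp only [hu, Pi.add_apply, Pi.single_eq_same, Pi.single_eq_of_ne hij,
      Pi.single_eq_of_ne hij.symm, Pi.single_eq_of_ne hii'.symm, Pi.single_eq_of_ne hi'j,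
      Pi.single_eq_of_ne hj'i, Pi.single_eq_of_ne hjj'.symm, add_zero, zero_add, not_lt] at h1 h2
    push_cast at h1 h2
    have key : ((d i' : ℝ≥0∞) + 1) * (d j' + 1) ≤
        ENNReal.ofReal (Real.exp (2 * ε)) * ((d i + 1) * (d j + 1)) := by
      have cast : ∀ a b : ℕ, ((a : ℝ≥0∞) + 1) * (b + 1) =
          ENNReal.ofReal (((a : ℝ) + 1) * (b + 1)) := by
        intro a b
        rw [ENNReal.ofReal_mul (by positivity), ENNReal.ofReal_add (by positivity) one_pos.le,
          ENNReal.ofReal_add (by positivity) one_pos.le]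
        simp
      rw [cast, cast, ← ENNReal.ofReal_mul (by positivity)]
      apply ENNReal.ofReal_le_ofReal
      calc _ ≤ (Real.exp ε * (d i + 1)) * (Real.exp ε * (d j + 1)) := by gcongr
        _ = _ := by rw [two_mul, Real.exp_add]; ring
    set X : ℝ≥0∞ := ((d i : ℝ≥0∞) + 1) * (d j + 1) with hX
    have hX0 : X ≠ 0 := by simp [hX]
    have hXt : X ≠ ⊤ := by simp [hX, ENNReal.mul_eq_top]
    refine (ENNReal.mul_le_mul_iff_left hX0 hXt).mp ?_
    calc P (d + u) * X = P (d + u') * (((d i' : ℝ≥0∞) + 1) * (d j' + 1)) := by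
          rw [hX, hP, hu, hu', poissonVec_add_two_singles_mul μ d hij,
            poissonVec_add_two_singles_mul μ d hij']
      _ ≤ P (d + u') * (ENNReal.ofReal (Real.exp (2 * ε)) * X) := by gcongr
      _ = _ := by ring
  calc ∑' c, P c * F (c + u') ≤ ∑' c, (G c + (B₁.indicator P c + B₂.indicator P c)) :=
        ENNReal.tsum_le_tsum hsplit
    _ = ∑' d, G (d + u) + ∑' c, (B₁.indicator P c + B₂.indicator P c) := by
        rw [ENNReal.tsum_add, hinj.tsum_eq hsupp]
    _ ≤ ∑' d, ENNReal.ofReal (Real.exp (2 * ε)) * (P (d + u') * F (d + u' + u)) +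
          2 * ENNReal.ofReal (Real.exp (1 / 6 - μ * ε ^ 2 / 12)) :=
        add_le_add (ENNReal.tsum_le_tsum hratio) hbad
    _ ≤ _ := by
        rw [ENNReal.tsum_mul_left]
        refine add_le_add_left (mul_le_mul_right ?_ _) _
        exact ENNReal.tsum_comp_le_tsum_of_injective hinj' fun c => P c * F (c + u)

end PoissonNoise

/-! ### Privacy of the protocol -/

section Privacy

/-- The noise parameter `24 log(1/δ) / min(ε, 1)²`. The truncation of `ε` at one keeps it in the
range of the Chernoff bound; it costs a constant factor for bounded `ε`. -/
noncomputable def noiseUT (ε δ : ℝ) : ℝ≥0 :=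
  Real.toNNReal (24 * Real.log (1 / δ) / min ε 1 ^ 2)

theorem log_one_div_pos {δ : ℝ} (hδ : 0 < δ) (hδ1 : δ < 1) : 0 < Real.log (1 / δ) :=
  Real.log_pos (by rw [lt_div_iff₀ hδ]; linarith)

theorem coe_noiseUT {ε δ : ℝ} (hδ : 0 < δ) (hδ1 : δ < 1) :
    (noiseUT ε δ : ℝ) = 24 * Real.log (1 / δ) / min ε 1 ^ 2 := by
  have := log_one_div_pos hδ hδ1
  exact Real.coe_toNNReal _ (by positivity)

theorem noiseUT_pos {ε δ : ℝ} (hε : 0 < ε) (hδ : 0 < δ) (hδ1 : δ < 1) : 0 < noiseUT ε δ := by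
  have := log_one_div_pos hδ hδ1
  have h : 0 < min ε 1 := lt_min hε one_pos
  exact Real.toNNReal_pos.mpr (by positivity)

variable {k : ℕ}

/-- The informative messages of users with data points `a ≠ b` differ only in the cells of `a` and
`b`. -/
theorem exists_dataVec_eq {a b : Fin k} (hab : a ≠ b) : ∃ w : Fin k × Bool → ℕ,
    dataVec a = w + (Pi.single (a, true) 1 + Pi.single (b, false) 1) ∧
    dataVec b = w + (Pi.single (a, false) 1 + Pi.single (b, true) 1) := by
  refine ⟨fun i => if i.1 = a ∨ i.1 = b ∨ i.2 = true then 0 else 1, ?_, ?_⟩ <;>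
  · ext ⟨l, c⟩
    simp only [dataVec_apply, Pi.add_apply, Pi.single_apply, Prod.mk.injEq]
    cases c <;> grind

theorem histLaw_randomiserUT_bind {β : Type} (lam : ℝ≥0) (N : ℕ) {m : ℕ} (x : Fin m → Fin k)
    (Q : (Fin k × Bool → ℕ) → PMF β) :
    (histLaw (randomiserUT lam N) x).bind Q = (poissonVec fun _ => m * (lam / N / 2)).bind
      fun c => Q (∑ i, dataVec (x i) + c) := by
  rw [histLaw_randomiserUT, pure_conv, PMF.bind_map]
  rfl

theorem protocolUT_isRobustlyShufflePrivate {ε δ γ : ℝ} (hε : 0 < ε) (hδ : 0 < δ) (hδ1 : δ < 1)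
    (n : ℕ) (α : ℝ) :
    (protocolUT k n (noiseUT ε δ) α).IsRobustlyShufflePrivate (2 * ε) (4 * δ ^ γ) γ := by
  intro N m hγ hmN x x' hxx' S
  by_cases hx : x = x'
  · subst hx
    refine le_add_right (le_mul_of_one_le_left' ?_)
    rw [ENNReal.one_le_ofReal, Real.one_le_exp_iff]
    positivity
  obtain ⟨i₀, hi₀⟩ := Function.ne_iff.mp hx
  have hother : ∀ i ∈ Finset.univ.erase i₀, dataVec (x i) = dataVec (x' i) := by
    intro i hi
    by_contra h
    have hne : x i ≠ x' i := fun h' => h (by rw [h'])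
    exact Finset.ne_of_mem_erase hi (Finset.card_le_one.mp hxx' i (by simpa using hne)
      i₀ (by simpa using hi₀))
  obtain ⟨w, hw, hw'⟩ := exists_dataVec_eq hi₀
  obtain ⟨Q, hQ⟩ := exists_shuffle_eq (ι := Fin k × Bool)
  change (shuffledMessages (randomiserUT (noiseUT ε δ) N) x).toOuterMeasure S ≤
    _ * (shuffledMessages (randomiserUT (noiseUT ε δ) N) x').toOuterMeasure S + _
  rw [shuffledMessages_eq_bind _ hQ, shuffledMessages_eq_bind _ hQ, histLaw_randomiserUT_bind,
    histLaw_randomiserUT_bind]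
  set g := ∑ i ∈ Finset.univ.erase i₀, dataVec (x' i) with hg
  have hsum : ∑ i, dataVec (x i) = g + w + (Pi.single (x i₀, true) 1 +
      Pi.single (x' i₀, false) 1) := by
    rw [← Finset.add_sum_erase _ _ (Finset.mem_univ i₀), Finset.sum_congr rfl hother, ← hg, hw]
    abel
  have hsum' : ∑ i, dataVec (x' i) = g + w + (Pi.single (x i₀, false) 1 +
      Pi.single (x' i₀, true) 1) := by
    rw [← Finset.add_sum_erase _ _ (Finset.mem_univ i₀), ← hg, hw']
    abel
  rw [hsum, hsum']
  set ε' := min ε 1 with hε'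
  have hε'0 : 0 < ε' := lt_min hε one_pos
  have h := poissonVec_bind_shift_le (m * (noiseUT ε δ / N / 2)) hε'0 (min_le_right _ _)
    (i := (x i₀, false)) (j := (x' i₀, true)) (i' := (x i₀, true)) (j' := (x' i₀, false))
    (by simp) (by simp) (by simp) (by simp) (by simpa using hi₀) (by simpa using hi₀.symm)
    (fun c => Q (g + w + c)) S
  have hshift : ∀ u c : Fin k × Bool → ℕ, g + w + u + c = g + w + (c + u) := fun u c => by abel
  simp only [hshift]
  refine h.trans (add_le_add ?_ ?_)
  · gcongr
    exact min_le_left _ _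
  · -- a share `m / N` of the noise is present, so the failure probability is about `δ ^ (m / N)`
    have hN : (0 : ℝ) < N := by
      have := i₀.pos
      exact_mod_cast this.trans_le hmN
    rw [← ENNReal.ofReal_ofNat, ← ENNReal.ofReal_mul (by norm_num)]
    apply ENNReal.ofReal_le_ofReal
    have hL := log_one_div_pos hδ hδ1
    have hexp : ((m * (noiseUT ε δ / N / 2) : ℝ≥0) : ℝ) * ε' ^ 2 / 12 =
        m / N * Real.log (1 / δ) := by
      push_cast
      rw [coe_noiseUT hδ hδ1, ← hε']
      field_simp
      ring
    have hθ : γ ≤ m / N := by rwa [le_div_iff₀ hN]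
    rw [hexp, Real.rpow_def_of_pos hδ]
    have h1 : 1 / 6 - m / N * Real.log (1 / δ) ≤ Real.log 2 + Real.log δ * γ := by
      have h2 : Real.log δ = - Real.log (1 / δ) := by simp
      have h3 := Real.log_two_gt_d9
      rw [h2]
      nlinarith
    calc 2 * Real.exp (1 / 6 - m / N * Real.log (1 / δ))
        ≤ 2 * Real.exp (Real.log 2 + Real.log δ * γ) := by gcongr
      _ = 4 * Real.exp (Real.log δ * γ) := by
        rw [Real.exp_add, Real.exp_log two_pos]; ring

end Privacy

/-! ### Moments of the test statistic -/

section Moments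

/-- The factorial moments of the Poisson distribution. -/
theorem hasSum_poisson_descFactorial (ν : ℝ≥0) (r : ℕ) :
    HasSum (fun n : ℕ => Real.exp (-ν) * ν ^ n / n.factorial * (n.descFactorial r : ℝ))
      ((ν : ℝ) ^ r) := by
  have h0 : ∀ n ∉ Set.range fun n : ℕ => n + r,
      Real.exp (-ν) * ν ^ n / n.factorial * (n.descFactorial r : ℝ) = 0 := by
    intro n hn
    have : n < r := by
      by_contra h
      exact hn ⟨n - r, by simp; omega⟩
    rw [Nat.descFactorial_eq_zero_iff_lt.mpr this]
    simp
  rw [← (add_left_injective r).hasSum_iff h0]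
  have := (hasSum_one_poissonMeasure ν).mul_left ((ν : ℝ) ^ r)
  rw [mul_one] at this
  convert! this using 2 with n
  have h1 : ((n + r).factorial : ℝ) = n.factorial * (n + r).descFactorial r := by
    have := Nat.factorial_mul_descFactorial (n := n + r) (k := r) (by omega)
    rw [Nat.add_sub_cancel] at this
    exact_mod_cast this.symm
  have h2 : ((n + r).descFactorial r : ℝ) ≠ 0 := by
    have := Nat.descFactorial_eq_zero_iff_lt (n := n + r) (k := r)
    exact_mod_cast fun h => absurd (this.mp h) (by omega)
  have h3 : (n.factorial : ℝ) ≠ 0 := by exact_mod_cast n.factorial_ne_zero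
  simp only [Function.comp_apply, h1, pow_add]
  field_simp

theorem integrable_poisson_descFactorial (ν : ℝ≥0) (r : ℕ) :
    Integrable (fun n : ℕ => (n.descFactorial r : ℝ)) (poissonMeasure ν) := by
  rw [integrable_poissonMeasure_iff]
  simpa using (hasSum_poisson_descFactorial ν r).summable

theorem integral_poisson_descFactorial (ν : ℝ≥0) (r : ℕ) :
    ∫ n : ℕ, (n.descFactorial r : ℝ) ∂poissonMeasure ν = (ν : ℝ) ^ r := by
  rw [integral_poissonMeasure]
  exact (hasSum_poisson_descFactorial ν r).tsum_eq

theorem cast_descFactorial_succ (n k : ℕ) :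
    (n.descFactorial (k + 1) : ℝ) = (n - k) * n.descFactorial k := by
  rw [Nat.descFactorial_succ, Nat.cast_mul]
  rcases le_or_gt k n with h | h
  · rw [Nat.cast_sub h]
  · simp [Nat.descFactorial_eq_zero_iff_lt.mpr h]

theorem cast_descFactorial_eqs (n : ℕ) :
    (n.descFactorial 1 : ℝ) = n ∧ (n.descFactorial 2 : ℝ) = n * (n - 1) ∧
    (n.descFactorial 3 : ℝ) = n * (n - 1) * (n - 2) ∧
    (n.descFactorial 4 : ℝ) = n * (n - 1) * (n - 2) * (n - 3) := by
  refine ⟨?_, ?_, ?_, ?_⟩ <;>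
  · simp only [cast_descFactorial_succ, Nat.descFactorial_zero]
    push_cast
    ring

/-- The contribution of a domain element with count `n` to the test statistic. -/
def excess (μ : ℝ) (n : ℕ) : ℝ := ((n : ℝ) - μ) ^ 2 - n

theorem excess_eq (μ : ℝ) (n : ℕ) :
    excess μ n = n.descFactorial 2 - 2 * μ * n.descFactorial 1 + μ ^ 2 * n.descFactorial 0 := by
  obtain ⟨h1, h2, -, -⟩ := cast_descFactorial_eqs n
  rw [h1, h2, Nat.descFactorial_zero, excess]
  push_cast
  ring

theorem excess_sq_eq (μ : ℝ) (n : ℕ) :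
    excess μ n ^ 2 = n.descFactorial 4 + (4 - 4 * μ) * n.descFactorial 3 +
      (2 - 8 * μ + 6 * μ ^ 2) * n.descFactorial 2 + (4 * μ ^ 2 - 4 * μ ^ 3) * n.descFactorial 1 +
      μ ^ 4 * n.descFactorial 0 := by
  obtain ⟨h1, h2, h3, h4⟩ := cast_descFactorial_eqs n
  rw [h1, h2, h3, h4, Nat.descFactorial_zero, excess]
  push_cast
  ring

theorem integral_excess (ν : ℝ≥0) (μ : ℝ) :
    ∫ n, excess μ n ∂poissonMeasure ν = ((ν : ℝ) - μ) ^ 2 := by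
  have hI := integrable_poisson_descFactorial ν
  simp only [excess_eq]
  rw [integral_add ((hI 2).sub' ((hI 1).const_mul _)) ((hI 0).const_mul _),
    integral_sub (hI 2) ((hI 1).const_mul _), integral_const_mul, integral_const_mul]
  simp only [integral_poisson_descFactorial]
  ring

theorem integrable_excess_sq (ν : ℝ≥0) (μ : ℝ) :
    Integrable (fun n => excess μ n ^ 2) (poissonMeasure ν) := by
  have hI := integrable_poisson_descFactorial ν
  simp only [excess_sq_eq]
  exact ((((hI 4).add ((hI 3).const_mul _)).add ((hI 2).const_mul _)).add
    ((hI 1).const_mul _)).add ((hI 0).const_mul _)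

theorem integral_excess_sq (ν : ℝ≥0) (μ : ℝ) :
    ∫ n, excess μ n ^ 2 ∂poissonMeasure ν =
      ((ν : ℝ) - μ) ^ 4 + 2 * ν ^ 2 + 4 * (ν - μ) ^ 2 * ν := by
  have hI := integrable_poisson_descFactorial ν
  simp only [excess_sq_eq]
  have h3 := (hI 4).fun_add ((hI 3).const_mul (4 - 4 * μ))
  have h2 := h3.fun_add ((hI 2).const_mul (2 - 8 * μ + 6 * μ ^ 2))
  have h1 := h2.fun_add ((hI 1).const_mul (4 * μ ^ 2 - 4 * μ ^ 3))
  rw [integral_add h1 ((hI 0).const_mul _), integral_add h2 ((hI 1).const_mul _),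
    integral_add h3 ((hI 2).const_mul _), integral_add (hI 4) ((hI 3).const_mul _)]
  simp only [integral_const_mul, integral_poisson_descFactorial]
  ring

theorem memLp_excess (ν : ℝ≥0) (μ : ℝ) : MemLp (excess μ) 2 (poissonMeasure ν) :=
  (memLp_two_iff_integrable_sq .of_discrete).mpr (integrable_excess_sq ν μ)

theorem variance_excess (ν : ℝ≥0) (μ : ℝ) :
    Var[excess μ; poissonMeasure ν] = 2 * ν ^ 2 + 4 * (ν - μ) ^ 2 * ν := by
  rw [variance_eq_sub (memLp_excess ν μ)]
  simp only [Pi.pow_apply, integral_excess_sq, integral_excess]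
  ring

variable {κ : Type} [Fintype κ]

/-- Chebyshev's inequality for the test statistic under independent Poisson counts. -/
theorem chebyshev_sum_excess (ν : κ → ℝ≥0) (μ : ℝ) {t : ℝ} (ht : 0 < t)
    (hV : 4 * ∑ j, (2 * (ν j : ℝ) ^ 2 + 4 * (ν j - μ) ^ 2 * ν j) ≤ t ^ 2) :
    (poissonVec ν).toMeasure {c | t ≤ |∑ j, excess μ (c j) - ∑ j, ((ν j : ℝ) - μ) ^ 2|} ≤
      ENNReal.ofReal (1 / 4) := by
  rw [poissonVec_toMeasure]
  set P := Measure.pi fun j => poissonMeasure (ν j)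
  set T : (κ → ℕ) → ℝ := ∑ j, fun c => excess μ (c j) with hT
  have hmem : ∀ j, MemLp (fun c : κ → ℕ => excess μ (c j)) 2 P := fun j =>
    (memLp_excess (ν j) μ).comp_measurePreserving
      (measurePreserving_eval (fun j => poissonMeasure (ν j)) j)
  have hTmem : MemLp T 2 P := memLp_finsetSum' _ fun j _ => hmem j
  have hvar : Var[T; P] = ∑ j, (2 * (ν j : ℝ) ^ 2 + 4 * (ν j - μ) ^ 2 * ν j) := by
    rw [hT, variance_sum_pi fun j => memLp_excess (ν j) μ]
    exact Finset.sum_congr rfl fun j _ => variance_excess _ _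
  have hmean : ∫ c, T c ∂P = ∑ j, ((ν j : ℝ) - μ) ^ 2 := by
    simp only [hT, Finset.sum_apply]
    rw [integral_finsetSum _ fun j _ => (hmem j).integrable (by norm_num)]
    refine Finset.sum_congr rfl fun j _ => ?_
    rw [← integral_excess]
    exact integral_comp_eval (μ := fun j => poissonMeasure (ν j)) (i := j) (f := excess μ)
      (Measurable.of_discrete).aestronglyMeasurable
  have h := meas_ge_le_variance_div_sq hTmem ht
  rw [hvar, hmean] at h
  simp only [hT, Finset.sum_apply] at h
  refine h.trans (ENNReal.ofReal_le_ofReal ?_)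
  rw [div_le_iff₀ (by positivity)]
  linarith

end Moments

/-! ### Correctness of the test under independent Poisson counts -/

section Test

variable {κ : Type} [Fintype κ]

/-- If all counts have the same mean `μ`, the statistic rarely exceeds the threshold. -/
theorem sum_excess_tail_of_uniform (μ : ℝ≥0) {τ : ℝ} (hτ : 0 < τ)
    (h : 8 * Fintype.card κ * (μ : ℝ) ^ 2 ≤ τ ^ 2) :
    (poissonVec fun _ : κ => μ).toMeasure {c | τ < ∑ j, excess μ (c j)} ≤
      ENNReal.ofReal (1 / 4) := by
  refine (measure_mono fun c hc => ?_).trans (chebyshev_sum_excess (fun _ : κ => μ) μ hτ ?_)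
  · have hc' : τ < ∑ j, excess μ (c j) := hc
    simpa using hc'.le.trans (le_abs_self _)
  · simp
    linarith

/-- If the squared deviations of the means from `μ` add up to some `D` that is at least twice the
threshold and large compared with the noise, the statistic rarely stays below the threshold. -/
theorem sum_excess_tail_of_far (ν : κ → ℝ≥0) (μ : ℝ) {τ D : ℝ} (hD : ∑ j, ((ν j : ℝ) - μ) ^ 2 = D)
    (hτ : 2 * τ ≤ D) (h1 : 256 ^ 2 ≤ D) (h2 : 256 * μ ≤ D)
    (h3 : 256 * Fintype.card κ * μ ^ 2 ≤ D ^ 2) :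
    (poissonVec ν).toMeasure {c | ∑ j, excess μ (c j) ≤ τ} ≤ ENNReal.ofReal (1 / 4) := by
  have hD0 : 0 < D := by linarith
  refine (measure_mono fun c hc => ?_).trans
    (chebyshev_sum_excess ν μ (t := D / 2) (by linarith) ?_)
  · have hc' : ∑ j, excess μ (c j) ≤ τ := hc
    rw [Set.mem_ofPred_eq, hD, abs_sub_comm]
    exact le_trans (by linarith) (le_abs_self _)
  · set s := Real.sqrt D with hs
    have hs2 : s ^ 2 = D := Real.sq_sqrt hD0.le
    have hs256 : 256 ≤ s := Real.le_sqrt_of_sq_le h1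
    -- no single deviation exceeds `s = √D`, so the cubic part of the variance is at most `4 s D`;
    -- each of the four resulting terms is at most `D ^ 2 / 64`
    have hle : ∀ j, 2 * (ν j : ℝ) ^ 2 + 4 * (ν j - μ) ^ 2 * ν j ≤
        4 * μ ^ 2 + (4 + 4 * μ + 4 * s) * (ν j - μ) ^ 2 := by
      intro j
      have h4 : |(ν j : ℝ) - μ| ≤ s := by
        apply Real.abs_le_sqrt
        rw [← hD]
        exact Finset.single_le_sum (f := fun j => ((ν j : ℝ) - μ) ^ 2)
          (fun i _ => sq_nonneg _) (Finset.mem_univ j)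
      have h5 : (ν j : ℝ) ≤ μ + s := by linarith [le_abs_self ((ν j : ℝ) - μ)]
      nlinarith [mul_le_mul_of_nonneg_left h5 (sq_nonneg ((ν j : ℝ) - μ)),
        sq_nonneg ((ν j : ℝ) - 2 * μ)]
    have hsum : ∑ j, (2 * (ν j : ℝ) ^ 2 + 4 * (ν j - μ) ^ 2 * ν j) ≤
        Fintype.card κ * (4 * μ ^ 2) + (4 + 4 * μ + 4 * s) * D :=
      (Finset.sum_le_sum fun j _ => hle j).trans_eq (by
        rw [Finset.sum_add_distrib, Finset.sum_const, Finset.card_univ, nsmul_eq_mul,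
          ← Finset.mul_sum, hD])
    have h6 : 256 * s ≤ D := by nlinarith
    have h7 := mul_le_mul_of_nonneg_right h6 hD0.le
    have h8 := mul_le_mul_of_nonneg_right h2 hD0.le
    have h9 := mul_le_mul_of_nonneg_right h1 hD0.le
    linarith

end Test

/-! ### The law of the verdict -/

section Verdict

theorem poissonVec_map_comp {ι κ : Type} [Fintype ι] [Fintype κ] (ν : ι → ℝ≥0) {e : κ → ι}
    (he : Function.Injective e) :
    (poissonVec ν).map (fun c => c ∘ e) = poissonVec (ν ∘ e) := by
  rw [← PMF.toMeasure_inj, ← PMF.toMeasure_map _ _ .of_discrete, poissonVec_toMeasure,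
    poissonVec_toMeasure]
  have h : iIndepFun (fun j (c : ι → ℕ) => c (e j)) (Measure.pi fun i => poissonMeasure (ν i)) :=
    (iIndepFun_pi (X := fun _ : ι => (id : ℕ → ℕ)) fun _ => aemeasurable_id).precomp he
  rw [iIndepFun_iff_map_fun_eq_pi_map fun j => Measurable.aemeasurable .of_discrete] at h
  have h2 : ∀ j, (Measure.pi fun i => poissonMeasure (ν i)).map (fun c => c (e j)) =
      poissonMeasure (ν (e j)) := fun j =>
    (measurePreserving_eval (fun i => poissonMeasure (ν i)) (e j)).map_eq
  simp only [h2] at h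
  exact h

variable {k : ℕ}

/-- The numbers of messages `(j, 1)`, read off from the histogram of all messages. -/
def trueCounts : (Fin k × Bool → ℕ) →+ (Fin k → ℕ) where
  toFun c j := c (j, true)
  map_zero' := rfl
  map_add' _ _ := rfl

theorem trueCounts_dataVec (x : Fin k) : trueCounts (dataVec x) = Pi.single x 1 := by
  ext j
  change dataVec x (j, true) = _
  rw [dataVec_apply]
  simp [Pi.single_apply, eq_comm]

theorem poissonVec_map_trueCounts (μ : ℝ≥0) :
    (poissonVec fun _ : Fin k × Bool => μ).map trueCounts = poissonVec fun _ => μ :=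
  poissonVec_map_comp (fun _ => μ) (e := fun j : Fin k => (j, true))
    fun _ _ h => congrArg Prod.fst h

/-- The answer of the analyser, as a function of the numbers of messages `(j, 1)`. -/
noncomputable def verdictUT (n : ℕ) (lam : ℝ≥0) (α : ℝ) (c : Fin k → ℕ) : Verdict :=
  open Classical in
  if 2 * (n : ℝ) * α ^ 2 < (k : ℝ) / n * ∑ j, excess (n / k + lam / 2) (c j) then .notUniform
  else .uniform

theorem analyserUT_eq (n : ℕ) (lam : ℝ≥0) (α : ℝ) (y : List (Fin k × Bool)) :
    analyserUT n lam α y = PMF.pure (verdictUT n lam α (trueCounts (countVec y))) := by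
  -- the two sides count with respect to different, but equal, boolean equality tests
  have h : ∀ j, y.count (j, true) = trueCounts (countVec y) j := by
    intro j
    simp only [trueCounts, countVec, AddMonoidHom.coe_mk, ZeroHom.coe_mk]
    congr 1
    exact lawful_beq_subsingleton _ _
  simp only [analyserUT, statisticZ, h]
  rfl

/-- With at least one user, the law of the verdict is that of the test applied to the histogram of
the data plus Poisson noise. -/
theorem protocolUT_run_eq (n : ℕ) (lam : ℝ≥0) (α : ℝ) {N : ℕ} (hN : N ≠ 0) (x : Fin N → Fin k) :
    (protocolUT k n lam α).run x =
      (PMF.pure (∑ i, (Pi.single (x i) 1 : Fin k → ℕ)) * poissonVec fun _ => lam / 2).map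
        (verdictUT n lam α) := by
  have h1 : (protocolUT k n lam α).run x =
      (((shuffledMessages (randomiserUT lam N) x).map countVec).map trueCounts).map
        (verdictUT n lam α) := by
    rw [PMF.map_comp, PMF.map_comp, Protocol.run]
    change (shuffledMessages (randomiserUT lam N) x).bind (analyserUT n lam α) = _
    rw [show analyserUT n lam α = _ from funext (analyserUT_eq n lam α)]
    rfl
  have h2 : (N : ℝ≥0) * (lam / N / 2) = lam / 2 := by
    have : (N : ℝ≥0) ≠ 0 := by exact_mod_cast hN
    field_simp
  rw [h1, shuffledMessages_map_countVec, histLaw_randomiserUT, h2, ← mapHom_apply trueCounts,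
    map_mul, mapHom_apply, mapHom_apply, PMF.pure_map, poissonVec_map_trueCounts, map_sum]
  simp only [trueCounts_dataVec]

theorem indep_bind_run_eq (n : ℕ) (lam : ℝ≥0) (α : ℝ) {N : ℕ} (hN : N ≠ 0) (p : PMF (Fin k)) :
    ((indep N fun _ => p).bind fun x => (protocolUT k n lam α).run x) =
      ((p.map fun j => (Pi.single j 1 : Fin k → ℕ)) ^ N * poissonVec fun _ => lam / 2).map
        (verdictUT n lam α) := by
  simp only [protocolUT_run_eq n lam α hN]
  rw [← PMF.map_bind, ← bind_conv]
  have h := indep_map_sum (fun j => (Pi.single j 1 : Fin k → ℕ)) N fun _ => p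
  rw [Finset.prod_const, Finset.card_univ, Fintype.card_fin] at h
  rw [← h]
  rfl

/-- The Poissonised protocol agrees, up to the probability that there are no users and hence no
noise, with the test applied to independent Poisson counts. -/
theorem map_verdictUT_le (n : ℕ) (lam : ℝ≥0) (α : ℝ) (p : PMF (Fin k)) (v : Verdict) :
    (poissonVec fun j => (n : ℝ≥0) * (p j).toNNReal + lam / 2).map (verdictUT n lam α) v ≤
      (protocolUT k n lam α).runPoissonised n p v + poisson n 0 := by
  have h1 : (poissonVec fun j => (n : ℝ≥0) * (p j).toNNReal + lam / 2) =
      compoundPoisson n (p.map fun j => (Pi.single j 1 : Fin k → ℕ)) *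
        poissonVec fun _ => lam / 2 := by
    rw [compoundPoisson_map_single, poissonVec_mul]
    rfl
  rw [h1, compoundPoisson, bind_conv, PMF.map_bind, PMF.bind_apply, Protocol.runPoissonised,
    PMF.bind_apply, ← tsum_ite_eq (0 : ℕ) fun _ => poisson n 0, ← ENNReal.tsum_add]
  refine ENNReal.tsum_le_tsum fun N => ?_
  by_cases hN : N = 0
  · subst hN
    rw [if_pos rfl]
    exact le_add_left (mul_le_of_le_one_right' (PMF.coe_le_one _ _))
  · rw [if_neg hN, add_zero, indep_bind_run_eq n lam α hN]

/-- If the test applied to independent Poisson counts errs with probability at most `1/4`, then the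
Poissonised protocol is correct with probability at least `2/3`. -/
theorem two_thirds_le_runPoissonised {n : ℕ} (hn : 11 ≤ n) (lam : ℝ≥0) (α : ℝ) (p : PMF (Fin k))
    (v : Verdict)
    (h : (poissonVec fun j => (n : ℝ≥0) * (p j).toNNReal + lam / 2).toMeasure
      {c | verdictUT n lam α c ≠ v} ≤ ENNReal.ofReal (1 / 4)) :
    2 / 3 ≤ (protocolUT k n lam α).runPoissonised n p v := by
  set P := poissonVec fun j => (n : ℝ≥0) * (p j).toNNReal + lam / 2 with hP
  have h1 : P.map (verdictUT n lam α) v = P.toMeasure {c | verdictUT n lam α c = v} := by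
    rw [← PMF.toOuterMeasure_apply_singleton, PMF.toOuterMeasure_map_apply,
      PMF.toMeasure_apply_eq_toOuterMeasure]
    rfl
  have h2 : (1 : ℝ≥0∞) ≤ P.toMeasure {c | verdictUT n lam α c = v} + ENNReal.ofReal (1 / 4) := by
    rw [← prob_add_prob_compl (μ := P.toMeasure) (s := {c | verdictUT n lam α c = v}) .of_discrete]
    exact add_le_add le_rfl h
  have h3 : poisson n 0 ≤ ENNReal.ofReal (1 / 12) := by
    rw [poisson_apply]
    apply ENNReal.ofReal_le_ofReal
    have h4 := Real.add_one_le_exp (n : ℝ)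
    have h5 : (11 : ℝ) ≤ n := by exact_mod_cast hn
    simp only [pow_zero, mul_one, Nat.factorial_zero, Nat.cast_one, div_one, NNReal.coe_natCast]
    rw [Real.exp_neg, ← one_div]
    exact one_div_le_one_div_of_le (by norm_num) (by linarith)
  have h4 : (2 / 3 : ℝ≥0∞) + ENNReal.ofReal (1 / 3) = 1 := by
    have : (2 / 3 : ℝ≥0∞) = ENNReal.ofReal (2 / 3) := by
      rw [ENNReal.ofReal_div_of_pos (by norm_num), ENNReal.ofReal_ofNat, ENNReal.ofReal_ofNat]
    rw [this, ← ENNReal.ofReal_add (by norm_num) (by norm_num)]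
    norm_num
  refine ENNReal.le_of_add_le_add_right (a := ENNReal.ofReal (1 / 3)) ENNReal.ofReal_ne_top ?_
  rw [h4]
  calc (1 : ℝ≥0∞) ≤ P.toMeasure {c | verdictUT n lam α c = v} + ENNReal.ofReal (1 / 4) := h2
    _ ≤ ((protocolUT k n lam α).runPoissonised n p v + ENNReal.ofReal (1 / 12)) +
          ENNReal.ofReal (1 / 4) := by
        rw [← h1]
        exact add_le_add ((map_verdictUT_le n lam α p v).trans (add_le_add le_rfl h3)) le_rfl
    _ = _ := by
        rw [add_assoc, ← ENNReal.ofReal_add (by norm_num) (by norm_num)]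
        norm_num

end Verdict

/-! ### Sample complexity -/

section SampleComplexity

variable {k : ℕ} [NeZero k]

theorem verdictUT_eq_notUniform_iff {n : ℕ} (hn : n ≠ 0) (lam : ℝ≥0) (α : ℝ) (c : Fin k → ℕ) :
    verdictUT n lam α c = .notUniform ↔
      2 * ((n : ℝ) ^ 2 * α ^ 2 / k) < ∑ j, excess (n / k + lam / 2) (c j) := by
  have hk : (0 : ℝ) < k := by exact_mod_cast Nat.pos_of_ne_zero (NeZero.ne k)
  have hn' : (0 : ℝ) < n := by exact_mod_cast Nat.pos_of_ne_zero hn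
  have h : 2 * (n : ℝ) * α ^ 2 < (k : ℝ) / n * ∑ j, excess (n / k + lam / 2) (c j) ↔
      2 * ((n : ℝ) ^ 2 * α ^ 2 / k) < ∑ j, excess (n / k + lam / 2) (c j) := by
    rw [div_mul_eq_mul_div, lt_div_iff₀ hn', ← mul_div_assoc, div_lt_iff₀ hk]
    ring_nf
  rw [← h, verdictUT]
  split_ifs with h' <;> simp [h']

/-- By the Cauchy–Schwarz inequality, distance from uniform in total variation forces a large
squared `ℓ²` distance; the right-hand side is the mean of the statistic, up to the factor `k / n`. -/
theorem four_mul_sq_le_of_tvDist (n : ℕ) {α : ℝ} (hα : 0 < α) {p : PMF (Fin k)}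
    (hp : α < tvDist p (PMF.uniformOfFintype (Fin k))) :
    4 * ((n : ℝ) ^ 2 * α ^ 2 / k) ≤ ∑ j, ((n : ℝ) * (p j).toReal - n / k) ^ 2 := by
  have hk : (0 : ℝ) < k := by exact_mod_cast Nat.pos_of_ne_zero (NeZero.ne k)
  set a : Fin k → ℝ := fun j => |(p j).toReal - 1 / k| with ha
  have h1 : 2 * α ≤ ∑ j, a j := by
    have h2 : tvDist p (PMF.uniformOfFintype (Fin k)) = (∑ j, a j) / 2 := by
      simp [tvDist, ha, PMF.uniformOfFintype_apply]
    rw [h2] at hp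
    linarith
  have h3 := sq_sum_le_card_mul_sum_sq (s := Finset.univ) (f := a)
  rw [Finset.card_univ, Fintype.card_fin] at h3
  have h4 : ∑ j, ((n : ℝ) * (p j).toReal - n / k) ^ 2 = n ^ 2 * ∑ j, a j ^ 2 := by
    rw [Finset.mul_sum]
    refine Finset.sum_congr rfl fun j _ => ?_
    rw [ha, sq_abs]
    ring
  rw [h4, ← mul_div_assoc, div_le_iff₀ hk]
  have h5 : (2 * α) ^ 2 ≤ k * ∑ j, a j ^ 2 := (pow_le_pow_left₀ (by positivity) h1 2).trans h3
  nlinarith [mul_le_mul_of_nonneg_left h5 (sq_nonneg (n : ℝ))]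

/-- The two hypotheses say that `n` dominates `√k / α²` and `k ^ (3 / 4) √lam / α`; the second term
is the price of the noise. -/
theorem protocolUT_solvesUniformityTesting {n : ℕ} (lam : ℝ≥0) {α : ℝ} (hα : 0 < α) (hα1 : α < 1)
    (h1 : 200 * Real.sqrt k ≤ n * α ^ 2)
    (h2 : 200 * (Real.sqrt k ^ 3 * lam) ≤ (n : ℝ) ^ 2 * α ^ 2) :
    SolvesUniformityTesting (protocolUT k n lam α) α n := by
  have hk1 : (1 : ℝ) ≤ k := by exact_mod_cast Nat.pos_of_ne_zero (NeZero.ne k)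
  have hk : (0 : ℝ) < k := by linarith
  set s := Real.sqrt k with hs
  have hs1 : 1 ≤ s := Real.one_le_sqrt.mpr hk1
  have hs2 : s ^ 2 = k := Real.sq_sqrt hk.le
  have hα2 : α ^ 2 ≤ 1 := by nlinarith
  have hn200 : (200 : ℝ) ≤ n := by
    have : (n : ℝ) * α ^ 2 ≤ n := mul_le_of_le_one_right (Nat.cast_nonneg n) hα2
    linarith
  have hn : 11 ≤ n := by
    have : (11 : ℝ) ≤ n := by linarith
    exact_mod_cast this
  set μ : ℝ := n / k + lam / 2 with hμ
  set a : ℝ := (n : ℝ) ^ 2 * α ^ 2 / k with ha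
  have hμ0 : 0 ≤ μ := by positivity
  have ha0 : 40000 ≤ a := by
    rw [ha, le_div_iff₀ hk, ← hs2]
    have h3 := mul_le_mul h1 h1 (by positivity) (by positivity)
    have h4 : (n : ℝ) * α ^ 2 * (n * α ^ 2) ≤ n ^ 2 * α ^ 2 := by
      have := mul_le_mul_of_nonneg_left hα2 (show 0 ≤ (n : ℝ) ^ 2 * α ^ 2 by positivity)
      linarith
    linarith
  -- in terms of `a`, the threshold is `2 * a` and the mean for a far distribution is at
  -- least `4 * a`
  have hsμ : s * μ ≤ 3 / 400 * a := by
    have h3 : s * μ * k = s * n + s ^ 3 * lam / 2 := by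
      have : μ * k = n + lam / 2 * k := by rw [hμ]; field_simp
      rw [mul_assoc, this, ← hs2]
      ring
    have h4 : 200 * (s * n) ≤ n ^ 2 * α ^ 2 := by
      have := mul_le_mul_of_nonneg_right h1 (Nat.cast_nonneg (α := ℝ) n)
      linarith
    have h5 : a * k = n ^ 2 * α ^ 2 := div_mul_cancel₀ _ hk.ne'
    refine le_of_mul_le_mul_right ?_ hk
    rw [h3, mul_assoc, h5]
    linarith
  have hμa : μ ≤ 3 / 400 * a := by nlinarith
  have hkμ : k * μ ^ 2 ≤ (3 / 400 * a) ^ 2 := by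
    rw [← hs2, ← mul_pow]
    exact pow_le_pow_left₀ (by positivity) hsμ 2
  constructor
  · apply two_thirds_le_runPoissonised hn
    set μ' : ℝ≥0 := n / k + lam / 2 with hμ'
    have hμμ' : (μ' : ℝ) = μ := by rw [hμ', hμ]; push_cast; rfl
    have hν : (fun j : Fin k => (n : ℝ≥0) * (PMF.uniformOfFintype (Fin k) j).toNNReal + lam / 2) =
        fun _ => μ' := by
      ext1 j
      simp [PMF.uniformOfFintype_apply, hμ', div_eq_mul_inv]
    rw [hν]
    refine (measure_mono fun c hc => ?_).trans
      (sum_excess_tail_of_uniform μ' (τ := 2 * a) (by linarith) ?_)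
    · have hc' : verdictUT n lam α c = .notUniform := by
        cases hv : verdictUT n lam α c
        · exact absurd hv hc
        · rfl
      rw [Set.mem_ofPred_eq, hμμ']
      exact (verdictUT_eq_notUniform_iff (by omega) lam α c).mp hc'
    · rw [hμμ', Fintype.card_fin]
      nlinarith
  · intro p hp
    apply two_thirds_le_runPoissonised hn
    have hD := four_mul_sq_le_of_tvDist n hα hp
    set D := ∑ j, ((n : ℝ) * (p j).toReal - n / k) ^ 2 with hDdef
    refine (measure_mono fun c hc => ?_).trans
      (sum_excess_tail_of_far _ μ (τ := 2 * a) (D := D) ?_ (by linarith) (by linarith)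
        (by linarith) ?_)
    · exact not_lt.mp fun h => hc ((verdictUT_eq_notUniform_iff (by omega) lam α c).mpr h)
    · refine Finset.sum_congr rfl fun j _ => ?_
      rw [hμ]
      push_cast [ENNReal.coe_toNNReal_eq_toReal]
      ring
    · rw [Fintype.card_fin]
      have : (4 * a) ^ 2 ≤ D ^ 2 := pow_le_pow_left₀ (by linarith) hD 2
      nlinarith

end SampleComplexity

end ShuffleTesting

theorem mainTheorem1 :
    ∃ lam : ℝ → ℝ → ℝ≥0,
      -- the noise parameter `lam ε δ` is positive and depends on nothing else
      (∀ ε δ : ℝ, 0 < ε → 0 < δ → δ < 1 → 0 < lam ε δ) ∧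
      -- privacy
      (∀ ε δ γ α : ℝ, 0 < ε → 0 < δ → δ < 1 → 0 < γ → γ ≤ 1 → 0 < α → α < 1 →
        ∀ k n : ℕ,
          (ShuffleTesting.protocolUT k n (lam ε δ) α).IsRobustlyShufflePrivate
            (2 * ε) (4 * δ ^ γ) γ) ∧
      -- sample complexity, for bounded `ε` and for `δ` bounded away from one
      (∀ ε₀ δ₀ : ℝ, 0 < ε₀ → 0 < δ₀ → δ₀ < 1 →
        ∃ C : ℝ, 0 < C ∧
          ∀ ε δ α : ℝ, 0 < ε → ε ≤ ε₀ → 0 < δ → δ ≤ δ₀ → 0 < α → α < 1 →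
            ∀ (k : ℕ) [NeZero k] (n : ℕ),
              C * ((k : ℝ) ^ (3 / 4 : ℝ) / (α * ε) * Real.sqrt (Real.log (1 / δ))
                  + Real.sqrt (k : ℝ) / α ^ 2) ≤ (n : ℝ) →
              ShuffleTesting.SolvesUniformityTesting
                (ShuffleTesting.protocolUT k n (lam ε δ) α) α n) := by
  refine ⟨ShuffleTesting.noiseUT, fun ε δ hε hδ hδ1 => ShuffleTesting.noiseUT_pos hε hδ hδ1,
    fun ε δ γ α hε hδ hδ1 _ _ _ _ k n =>
      ShuffleTesting.protocolUT_isRobustlyShufflePrivate hε hδ hδ1 n α, ?_⟩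
  intro ε₀ δ₀ _ _ hδ₀1
  set E := max 1 ε₀ with hE
  have hE1 : 1 ≤ E := le_max_left _ _
  -- the first term of the lower bound on `n` enters squared, and `noiseUT` is at most
  -- `24 * E ^ 2 * log (1 / δ) / ε ^ 2`
  refine ⟨200 * E, by positivity, ?_⟩
  intro ε δ α hε hεε₀ hδ hδδ₀ hα hα1 k _ n hn
  have hδ1 : δ < 1 := hδδ₀.trans_lt hδ₀1
  have hL := ShuffleTesting.log_one_div_pos hδ hδ1
  set L := Real.log (1 / δ) with hLdef
  set s := Real.sqrt k with hs
  have hs0 : 0 ≤ s := Real.sqrt_nonneg _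
  set X := (k : ℝ) ^ (3 / 4 : ℝ) / (α * ε) * Real.sqrt L with hX
  have hX0 : 0 ≤ X := by positivity
  have hY0 : 0 ≤ s / α ^ 2 := by positivity
  have hX2 : X ^ 2 * α ^ 2 = s ^ 3 * L / ε ^ 2 := by
    have h1 : ((k : ℝ) ^ (3 / 4 : ℝ)) ^ 2 = s ^ 3 := by
      rw [hs, Real.sqrt_eq_rpow, ← Real.rpow_natCast, ← Real.rpow_natCast,
        ← Real.rpow_mul (Nat.cast_nonneg k), ← Real.rpow_mul (Nat.cast_nonneg k)]
      norm_num
    rw [hX, mul_pow, div_pow, h1, Real.sq_sqrt hL.le]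
    field_simp
  apply ShuffleTesting.protocolUT_solvesUniformityTesting _ hα hα1
  · have h1 : 200 * (s / α ^ 2) ≤ n := by nlinarith
    rw [← mul_div_assoc, div_le_iff₀ (by positivity)] at h1
    exact h1
  · have h1 : 200 * E * X ≤ n := by
      refine le_trans ?_ hn
      gcongr
      linarith
    have h2 : (200 * E * X) ^ 2 * α ^ 2 ≤ (n : ℝ) ^ 2 * α ^ 2 := by gcongr
    refine le_trans ?_ h2
    rw [ShuffleTesting.coe_noiseUT hδ hδ1, ← hLdef]
    have hmin : ε / E ≤ min ε 1 := by
      refine le_min (div_le_self hε.le hE1) ?_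
      rw [div_le_one (by positivity)]
      exact hεε₀.trans (le_max_right _ _)
    have h3 : 24 * L / min ε 1 ^ 2 ≤ 24 * L / (ε / E) ^ 2 := by gcongr
    calc 200 * (s ^ 3 * (24 * L / min ε 1 ^ 2))
        ≤ 200 * (s ^ 3 * (24 * L / (ε / E) ^ 2)) := by gcongr
      _ = 4800 * E ^ 2 * (s ^ 3 * L / ε ^ 2) := by field_simp; ring
      _ ≤ 40000 * E ^ 2 * (s ^ 3 * L / ε ^ 2) := by gcongr; norm_num
      _ = (200 * E * X) ^ 2 * α ^ 2 := by rw [← hX2]; ring
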